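/- Let $m\ge 4$ identical machines and a finite set of jobs be given, where job $j$ has a release time $r_j\ge 0$ and a processing time $p_j>0$. Jobs are processed non-preemptively; a feasible schedule gives each job $j$ a machine and a start time $s_j\ge r_j$ such that no machine processes two jobs at the same time, and its makespan is $\max_j (s_j+p_j)$. Job $j$ becomes known to an online algorithm only at time $r_j$. Generalized SLEEPY with dynamic locking and parameters $\lambda\ge 1$, $\alpha\ge 0$ is the following online algorithm. At any moment $t$, a job $j$ is pending if $r_j\le t$ and it has not been started, and a machine is idle if it is neither processing a job nor locked. Whenever there are an idle machine and a pending job, the algorithm starts a longest pending job $j$ on an arbitrary idle machine (so $s_j=t$), and locks all machines until time $s_j+\alpha_j p_j$, where $\alpha_j=\lambda^{-s_j/p_j}\alpha$; no job may start on a locked machine. Ties between longest pending jobs are broken arbitrarily. With $\alpha=\frac{1}{4m^2}$ and $\lambda=4^{25/6}$, the algorithm is $\left(1.5-\frac{1}{4^{20}m^2}\right)$-competitive: on every such set of jobs it produces a schedule, and every schedule that it can produce (for any of its arbitrary choices) has makespan at most $1.5-\frac{1}{4^{20}m^2}$ times the optimal offline makespan. In particular the competitive ratio is $1.5-\frac{1}{O(m^2)}$.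 -/

import Mathlib

noncomputable section

namespace Sleepy

/-- A set of jobs, indexed by `ι`: every job `j` has a release time `r_j ≥ 0` and a
processing time `p_j > 0`. -/
structure JobSet (ι : Type*) where
  release : ι → ℝ
  proc : ι → ℝ
  release_nonneg : ∀ j, 0 ≤ release j
  proc_pos : ∀ j, 0 < proc j

/-- A non-preemptive assignment of start times and machines to the jobs, on `m` machines. -/
structure Schedule (m : ℕ) (ι : Type*) where
  start : ι → ℝ
  machine : ι → Fin m

variable {m : ℕ} {ι : Type*}

/-- The completion time `C_j = s_j + p_j`. -/
def Schedule.completion (σ : Schedule m ι) (J : JobSet ι) (j : ι) : ℝ :=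
  σ.start j + J.proc j

/-- The maximum completion time of a job (used for finitely many jobs; it is `0` without jobs). -/
def Schedule.makespan (σ : Schedule m ι) (J : JobSet ι) : ℝ :=
  ⨆ j, σ.completion J j

/-- No job starts before its release time, and no machine processes two jobs at the same time. -/
structure Schedule.Feasible (σ : Schedule m ι) (J : JobSet ι) : Prop where
  release_le_start : ∀ j, J.release j ≤ σ.start j
  no_overlap : ∀ i j, i ≠ j → σ.machine i = σ.machine j →
    σ.completion J i ≤ σ.start j ∨ σ.completion J j ≤ σ.start i

/-- The optimal offline makespan on `m` machines. -/
def optMakespan (m : ℕ) (J : JobSet ι) : ℝ :=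
  sInf {x : ℝ | ∃ τ : Schedule m ι, τ.Feasible J ∧ τ.makespan J = x}

/-- Job `j` is processing at time `t`. -/
def Schedule.Processing (σ : Schedule m ι) (J : JobSet ι) (j : ι) (t : ℝ) : Prop :=
  σ.start j ≤ t ∧ t < σ.completion J j

/-- Job `j` is pending at time `t`: released, but not started. -/
def Schedule.Pending (σ : Schedule m ι) (J : JobSet ι) (j : ι) (t : ℝ) : Prop :=
  J.release j ≤ t ∧ t < σ.start j

/-- The dynamic locking parameter `α_j = λ ^ (-s_j / p_j) * α` of job `j`. -/
def Schedule.lockParam (σ : Schedule m ι) (J : JobSet ι) (lam α : ℝ) (j : ι) : ℝ :=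
  lam ^ (-(σ.start j / J.proc j)) * α

/-- At time `t`, all machines are locked because of job `j`, i.e. `s_j ≤ t < s_j + α_j p_j`. -/
def Schedule.LockedBy (σ : Schedule m ι) (J : JobSet ι) (lam α : ℝ) (j : ι) (t : ℝ) : Prop :=
  σ.start j ≤ t ∧ t < σ.start j + σ.lockParam J lam α j * J.proc j

/-- Machine `M` is idle at time `t` (neither busy nor locked) as far as the jobs in `S` are
concerned. With `S = Set.univ` this is the state of `M` at time `t` after the decisions made at
that time; with `S = {j}ᶜ` and `t = s_j` it is the state which the algorithm sees when it is
about to start `j`. -/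
def Schedule.IdleWrt (σ : Schedule m ι) (J : JobSet ι) (lam α : ℝ) (S : Set ι)
    (M : Fin m) (t : ℝ) : Prop :=
  ∀ i ∈ S, ¬ (σ.machine i = M ∧ σ.Processing J i t) ∧ ¬ σ.LockedBy J lam α i t

/-- `σ` is a schedule that Generalized SLEEPY with dynamic locking and parameters `lam`, `α` can
produce on `J`, for some choice among idle machines and among longest pending jobs. -/
structure IsSleepySchedule (lam α : ℝ) (J : JobSet ι) (σ : Schedule m ι) : Prop where
  feasible : σ.Feasible J
  /-- A job is started only on an idle machine. -/
  start_on_idle : ∀ j, σ.IdleWrt J lam α {j}ᶜ (σ.machine j) (σ.start j)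
  /-- The job that is started is a longest one among the pending jobs. -/
  longest_first : ∀ j i, σ.Pending J i (σ.start j) → J.proc i ≤ J.proc j
  /-- At no moment is a machine left idle while a job is pending. -/
  no_delay : ∀ t : ℝ, (∃ j, σ.Pending J j t) →
    ∀ M : Fin m, ¬ σ.IdleWrt J lam α Set.univ M t

end Sleepy

end

namespace Sleepy

variable {m : ℕ} {ι : Type*}

/-! After rescaling, some offline schedule `τ` has length `1`. Suppose the last job `n` ends after
`3/2 - g`, with `g` of order `1/m²`. It waited longer than all locks together, which total at most
`1/(4m)`. So there is a time `z` from which locks alone delay `n`, while all `m` machines process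
jobs up to `z` (`exists_lock_phase`). By longest-first each of these jobs is at least as long as
`n`, unless it started before `r_n`; then its length is at least about `1/2`. With `n` they are `m +
1` jobs, so `τ` runs two of them, `a` and `b`, on one machine, and `r_a + p_a + p_b ≤ 1`.

If `p_n` is at most about `1/2`, volume decides. At time `r_a` the backlog against `τ` is at most
about `m * r_a / 2` (`work_sub_work_le`), and from then on all machines are busy except for locks
and a short gap (`work_bound`). The total load would exceed what `τ` can process.

If `p_n` is clearly above `1/2`, locks decide (`false_of_long`). In `τ` each such long job excludes
all the others from its machine. Hence, if `F` is the set of jobs started in the final lock phase,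
at least `2(|F| + 1)` of the jobs running at `z` have length about `1/2` and started before `r_n`.
These starts lie in a window of about twice the total lock length of `F`, yet are separated by their
own locks. Dynamic locking makes those no shorter than the locks of `F`, because their ratio
start/length is smaller; so they do not fit. -/

/-- The length `α_j p_j` of the lock caused by job `j`. -/
noncomputable def Schedule.lock (σ : Schedule m ι) (J : JobSet ι) (lam α : ℝ) (j : ι) : ℝ :=
  σ.lockParam J lam α j * J.proc j

lemma Schedule.lock_pos (σ : Schedule m ι) (J : JobSet ι) {lam α : ℝ} (hlam : 0 < lam)
    (hα : 0 < α) (j : ι) : 0 < σ.lock J lam α j := by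
  unfold Schedule.lock Schedule.lockParam
  have := J.proc_pos j
  have := Real.rpow_pos_of_pos hlam (-(σ.start j / J.proc j))
  positivity

/-! ### Existence of a run -/

/-- The state of a run of the algorithm at time `T`, when the jobs in `S` have been started. -/
structure IsSleepyPrefix (lam α : ℝ) (J : JobSet ι) (S : Finset ι) (σ : Schedule m ι)
    (T : ℝ) : Prop where
  nonneg : 0 ≤ T
  release_le_start : ∀ j ∈ S, J.release j ≤ σ.start j
  start_le : ∀ j ∈ S, σ.start j ≤ T
  start_on_idle : ∀ j ∈ S, σ.IdleWrt J lam α (S \ {j}) (σ.machine j) (σ.start j)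
  longest_first : ∀ j ∈ S, ∀ i, J.release i ≤ σ.start j → (i ∈ S → σ.start j < σ.start i) →
    J.proc i ≤ J.proc j
  no_delay : ∀ t < T, ∀ i, J.release i ≤ t → (i ∈ S → t < σ.start i) →
    ∀ M, ¬ σ.IdleWrt J lam α S M t

lemma Schedule.IdleWrt.congr {lam α : ℝ} {J : JobSet ι} {S : Set ι} {σ σ' : Schedule m ι}
    {M : Fin m} {t : ℝ} (h : σ.IdleWrt J lam α S M t)
    (hs : ∀ i ∈ S, σ'.start i = σ.start i) (hM : ∀ i ∈ S, σ'.machine i = σ.machine i) :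
    σ'.IdleWrt J lam α S M t := by
  intro i hi
  have := h i hi
  simpa only [Schedule.Processing, Schedule.LockedBy, Schedule.lockParam, Schedule.completion,
    hs i hi, hM i hi] using this

lemma Schedule.IdleWrt.mono {lam α : ℝ} {J : JobSet ι} {S S' : Set ι} {σ : Schedule m ι}
    {M : Fin m} {t : ℝ} (h : σ.IdleWrt J lam α S M t) (hS : S' ⊆ S) :
    σ.IdleWrt J lam α S' M t := fun i hi => h i (hS hi)

/-- The next decision: there is a first time at which some machine is idle and a job waits. -/
lemma IsSleepyPrefix.exists_next [Finite ι] (hm : 0 < m) {lam α : ℝ} {J : JobSet ι}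
    {S : Finset ι} {σ : Schedule m ι} {T : ℝ} {i₀ : ι} (hi₀ : i₀ ∉ S) :
    ∃ T', T ≤ T' ∧ (∃ i ∉ S, J.release i ≤ T') ∧ (∃ M, σ.IdleWrt J lam α S M T') ∧
      ∀ t, T ≤ t → t < T' → ∀ i ∉ S, J.release i ≤ t → ∀ M, ¬ σ.IdleWrt J lam α S M t := by
  classical
  cases nonempty_fintype ι
  let Good : ℝ → Prop := fun t => T ≤ t ∧ (∃ i ∉ S, J.release i ≤ t) ∧
    ∃ M, σ.IdleWrt J lam α S M t
  let E : Finset ℝ := {T} ∪ Finset.univ.image J.release ∪ Finset.univ.image (σ.completion J) ∪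
    Finset.univ.image (fun j => σ.start j + σ.lockParam J lam α j * J.proc j)
  have hT : T ∈ E := by simp [E]
  have hr : ∀ i, J.release i ∈ E := fun i => by simp [E]
  have hc : ∀ i, σ.completion J i ∈ E := fun i => by simp [E]
  have hl : ∀ i, σ.start i + σ.lockParam J lam α i * J.proc i ∈ E := fun i => by simp [E]
  -- Between consecutive events in `E` no release or machine state changes, so a good time can be
  -- moved back to the last event.
  have key : ∀ t, Good t → ∃ e ∈ E, e ≤ t ∧ Good e := by
    rintro t ⟨h1, ⟨i, hi, hit⟩, M, hM⟩
    have hne : (E.filter (· ≤ t)).Nonempty := ⟨T, by simp [hT, h1]⟩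
    obtain ⟨he, hle⟩ := Finset.mem_filter.1 ((E.filter (· ≤ t)).max'_mem hne)
    have hmax : ∀ x ∈ E, x ≤ t → x ≤ (E.filter (· ≤ t)).max' hne := fun x hx hxt =>
      Finset.le_max' _ _ (by simp [hx, hxt])
    refine ⟨_, he, hle, hmax T hT h1, ⟨i, hi, hmax _ (hr i) hit⟩, M, ?_⟩
    intro k hk
    obtain ⟨a, b⟩ := hM k hk
    refine ⟨fun hp => a ⟨hp.1, hp.2.1.trans hle, ?_⟩, fun hp => b ⟨hp.1.trans hle, ?_⟩⟩
    · by_contra! hcon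
      exact absurd (hmax _ (hc k) hcon) (not_le.2 hp.2.2)
    · by_contra! hcon
      exact absurd (hmax _ (hl k) hcon) (not_le.2 hp.2)
  have hEne : E.Nonempty := ⟨T, hT⟩
  have hbig : Good (E.max' hEne) := by
    refine ⟨E.le_max' _ hT, ⟨i₀, hi₀, E.le_max' _ (hr i₀)⟩, ⟨0, hm⟩, ?_⟩
    intro k hk
    exact ⟨fun hp => absurd (E.le_max' _ (hc k)) (not_le.2 hp.2.2),
      fun hp => absurd (E.le_max' _ (hl k)) (not_le.2 hp.2)⟩
  have hne : (E.filter Good).Nonempty :=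
    ⟨_, Finset.mem_filter.2 ⟨E.max'_mem hEne, hbig⟩⟩
  obtain ⟨-, hG⟩ := Finset.mem_filter.1 ((E.filter Good).min'_mem hne)
  refine ⟨_, hG.1, hG.2.1, hG.2.2, ?_⟩
  intro t hTt htlt i hi hit M hM
  obtain ⟨e, heE, het, heG⟩ := key t ⟨hTt, ⟨i, hi, hit⟩, M, hM⟩
  exact absurd ((E.filter Good).min'_le e (Finset.mem_filter.2 ⟨heE, heG⟩))
    (not_le.2 (het.trans_lt htlt))

/-- Positive locks put all earlier starts strictly before the new one, so the new job cannot violate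
the conditions already met there. -/
lemma IsSleepyPrefix.exists_succ [Finite ι] (hm : 0 < m) {lam α : ℝ} (hlam : 0 < lam)
    (hα : 0 < α) {J : JobSet ι} {S : Finset ι} {σ : Schedule m ι} {T : ℝ}
    (h : IsSleepyPrefix lam α J S σ T) {i₀ : ι} (hi₀ : i₀ ∉ S) :
    ∃ S' σ' T', S'.card = S.card + 1 ∧ IsSleepyPrefix (m := m) lam α J S' σ' T' := by
  classical
  cases nonempty_fintype ι
  obtain ⟨T', hTT', ⟨i₁, hi₁, hi₁'⟩, ⟨M, hM⟩, hno⟩ :=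
    IsSleepyPrefix.exists_next (T := T) (J := J) (σ := σ) (lam := lam) (α := α) hm hi₀
  obtain ⟨i, hi, hmax⟩ := (Finset.univ.filter fun i => i ∉ S ∧ J.release i ≤ T').exists_max_image
    J.proc ⟨i₁, by simp [hi₁, hi₁']⟩
  simp only [Finset.mem_filter, Finset.mem_univ, true_and] at hi hmax
  obtain ⟨hiS, hir⟩ := hi
  have hlt : ∀ j ∈ S, σ.start j < T' := by
    intro j hj
    have h1 := (hM j hj).2
    have h2 := σ.lock_pos J hlam hα j
    simp only [Schedule.LockedBy, not_and, not_lt] at h1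
    have h3 := h1 ((h.start_le j hj).trans hTT')
    unfold Schedule.lock at h2
    linarith
  let σ' : Schedule m ι := ⟨Function.update σ.start i T', Function.update σ.machine i M⟩
  have hne : ∀ j ∈ S, j ≠ i := fun j hj e => hiS (e ▸ hj)
  have hs : ∀ j ∈ S, σ'.start j = σ.start j := fun j hj => by simp [σ', hne j hj]
  have hMs : ∀ j ∈ S, σ'.machine j = σ.machine j := fun j hj => by simp [σ', hne j hj]
  have hsi : σ'.start i = T' := by simp [σ']
  have hMi : σ'.machine i = M := by simp [σ']
  have hidle : ∀ {N t}, σ'.IdleWrt J lam α (insert i S : Finset ι) N t →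
      σ.IdleWrt J lam α S N t := fun {N t} hh =>
    (hh.mono (S' := (S : Set ι)) (by simp)).congr (fun j hj => (hs j hj).symm)
      (fun j hj => (hMs j hj).symm)
  refine ⟨insert i S, σ', T', Finset.card_insert_of_notMem hiS, h.nonneg.trans hTT', ?_, ?_, ?_,
    ?_, ?_⟩
  · intro j hj
    rcases Finset.mem_insert.1 hj with rfl | hj
    · rw [hsi]; exact hir
    · rw [hs j hj]; exact h.release_le_start j hj
  · intro j hj
    rcases Finset.mem_insert.1 hj with rfl | hj
    · rw [hsi]
    · rw [hs j hj]; exact (hlt j hj).le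
  · intro j hj
    rcases Finset.mem_insert.1 hj with rfl | hj
    · rw [hsi, hMi]
      refine (hM.congr hs hMs).mono ?_
      intro k hk
      simp at hk
      tauto
    · rw [hs j hj, hMs j hj]
      have h1 := (h.start_on_idle j hj).congr (σ' := σ') (fun k hk => hs k (by simpa using hk.1))
        (fun k hk => hMs k (by simpa using hk.1))
      intro k hk
      have hjT := hlt j hj
      by_cases hki : k = i
      · subst hki
        refine ⟨fun hp => ?_, fun hp => ?_⟩
        · have := hp.2.1; rw [hsi] at this; linarith
        · have := hp.1; rw [hsi] at this; linarith
      · refine h1 k ?_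
        simp at hk ⊢
        tauto
  · intro j hj k hk hkS
    rcases Finset.mem_insert.1 hj with rfl | hj
    · rw [hsi] at hk hkS
      by_cases hkj : k = j
      · rw [hkj]
      · refine hmax k ⟨fun hkS' => ?_, hk⟩
        have h1 := hkS (Finset.mem_insert_of_mem hkS')
        rw [hs k hkS'] at h1
        exact absurd (hlt k hkS') (not_lt.2 h1.le)
    · rw [hs j hj] at hk hkS
      refine h.longest_first j hj k hk fun hkS' => ?_
      have := hkS (Finset.mem_insert_of_mem hkS')
      rwa [hs k hkS'] at this
  · intro t ht k hk hkS N hN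
    have hN' := hidle hN
    have hkS' : k ∈ S → t < σ.start k := fun hkS' => by
      have := hkS (Finset.mem_insert_of_mem hkS')
      rwa [hs k hkS'] at this
    rcases lt_or_ge t T with htT | htT
    · exact h.no_delay t htT k hk hkS' N hN'
    · refine hno t htT ht k (fun hkS'' => ?_) hk N hN'
      exact absurd (h.start_le k hkS'') (not_le.2 (htT.trans_lt (hkS' hkS'')))

theorem exists_isSleepySchedule [Finite ι] (hm : 0 < m) {lam α : ℝ} (hlam : 0 < lam)
    (hα : 0 < α) (J : JobSet ι) : ∃ σ : Schedule m ι, IsSleepySchedule lam α J σ := by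
  classical
  cases nonempty_fintype ι
  have key : ∀ k ≤ Fintype.card ι, ∃ S σ T, S.card = k ∧
      IsSleepyPrefix (m := m) lam α J S σ T := by
    intro k
    induction k with
    -- The values for unstarted jobs are arbitrary; `no_delay` is vacuous because nothing is
    -- released before time `0`.
    | zero => exact fun _ => ⟨∅, ⟨fun _ => 0, fun _ => ⟨0, hm⟩⟩, 0, by simp, le_rfl, by simp,
        by simp, by simp, by simp,
        fun t ht i hi => absurd (J.release_nonneg i) (not_le.2 (hi.trans_lt ht))⟩
    | succ k ih =>
      intro hk
      obtain ⟨S, σ, T, hS, h⟩ := ih (by omega)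
      obtain ⟨i₀, hi₀⟩ : ∃ i, i ∉ S := by
        by_contra! hcon
        have := Finset.eq_univ_iff_forall.2 hcon
        rw [this, Finset.card_univ] at hS
        omega
      obtain ⟨S', σ', T', hS', h'⟩ := h.exists_succ hm hlam hα hi₀
      exact ⟨S', σ', T', by omega, h'⟩
  obtain ⟨S, σ, T, hS, h⟩ := key _ le_rfl
  obtain rfl : S = Finset.univ := (Finset.card_eq_iff_eq_univ S).1 hS
  have hidle : ∀ j, σ.IdleWrt J lam α {j}ᶜ (σ.machine j) (σ.start j) := fun j =>
    (h.start_on_idle j (Finset.mem_univ j)).mono (by simp [Set.compl_eq_univ_sdiff])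
  refine ⟨σ, ⟨fun j => h.release_le_start j (Finset.mem_univ j), ?_⟩, hidle, ?_, ?_⟩
  · intro i j hij hM
    rcases le_total (σ.start i) (σ.start j) with hle | hle
    · left
      by_contra! hcon
      exact (hidle j i (by simpa using hij)).1 ⟨hM, hle, hcon⟩
    · right
      by_contra! hcon
      exact (hidle i j (by simpa using hij.symm)).1 ⟨hM.symm, hle, hcon⟩
  · intro j i hp
    exact h.longest_first j (Finset.mem_univ j) i hp.1 fun _ => hp.2
  · rintro t ⟨j, hj⟩ M hM
    exact h.no_delay t (hj.2.trans_le (h.start_le j (Finset.mem_univ j))) j hj.1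
      (fun _ => hj.2) M (by simpa using hM)

/-! ### Scale invariance -/

/-- The instance in which time is measured in units of `c`. -/
noncomputable def JobSet.rescale (J : JobSet ι) (c : ℝ) (hc : 0 < c) : JobSet ι where
  release j := J.release j / c
  proc j := J.proc j / c
  release_nonneg j := div_nonneg (J.release_nonneg j) hc.le
  proc_pos j := div_pos (J.proc_pos j) hc

/-- The schedule in which time is measured in units of `c`. -/
noncomputable def Schedule.rescale (σ : Schedule m ι) (c : ℝ) : Schedule m ι where
  start j := σ.start j / c
  machine := σ.machine

section Rescale

variable {J : JobSet ι} {σ : Schedule m ι} {c : ℝ} (hc : 0 < c)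
include hc

lemma Schedule.completion_rescale (j : ι) :
    (σ.rescale c).completion (J.rescale c hc) j = σ.completion J j / c := by
  simp [Schedule.completion, Schedule.rescale, JobSet.rescale, add_div]

/-- The exponent depends only on the ratio `s_j / p_j`, so locks scale like job lengths. -/
lemma Schedule.lockParam_rescale (lam α : ℝ) (j : ι) :
    (σ.rescale c).lockParam (J.rescale c hc) lam α j = σ.lockParam J lam α j := by
  simp only [Schedule.lockParam, Schedule.rescale, JobSet.rescale]
  rw [div_div_div_cancel_right₀ hc.ne']

lemma Schedule.Feasible.rescale (h : σ.Feasible J) :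
    (σ.rescale c).Feasible (J.rescale c hc) where
  release_le_start j := div_le_div_of_nonneg_right (h.release_le_start j) hc.le
  no_overlap i j hij hM := by
    simp only [Schedule.completion_rescale hc]
    exact (h.no_overlap i j hij hM).imp (fun h => div_le_div_of_nonneg_right h hc.le)
      (fun h => div_le_div_of_nonneg_right h hc.le)

lemma Schedule.pending_rescale (j : ι) (t : ℝ) :
    (σ.rescale c).Pending (J.rescale c hc) j t ↔ σ.Pending J j (t * c) := by
  simp only [Schedule.Pending, Schedule.rescale, JobSet.rescale, div_le_iff₀ hc, lt_div_iff₀ hc]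

lemma Schedule.idleWrt_rescale (lam α : ℝ) (S : Set ι) (M : Fin m) (t : ℝ) :
    (σ.rescale c).IdleWrt (J.rescale c hc) lam α S M t ↔ σ.IdleWrt J lam α S M (t * c) := by
  have h1 : ∀ i, (σ.rescale c).Processing (J.rescale c hc) i t ↔ σ.Processing J i (t * c) := by
    intro i
    simp only [Schedule.Processing, Schedule.completion_rescale hc, lt_div_iff₀ hc]
    simp only [Schedule.rescale, div_le_iff₀ hc]
  have h2 : ∀ i, (σ.rescale c).LockedBy (J.rescale c hc) lam α i t ↔
      σ.LockedBy J lam α i (t * c) := by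
    intro i
    simp only [Schedule.LockedBy, Schedule.lockParam_rescale hc]
    simp only [Schedule.rescale, JobSet.rescale, div_le_iff₀ hc]
    rw [← mul_div_assoc, ← add_div, lt_div_iff₀ hc]
  simp only [Schedule.IdleWrt, h1, h2]
  rfl

lemma IsSleepySchedule.rescale {lam α : ℝ} (h : IsSleepySchedule lam α J σ) :
    IsSleepySchedule lam α (J.rescale c hc) (σ.rescale c) where
  feasible := h.feasible.rescale hc
  start_on_idle j := by
    rw [Schedule.idleWrt_rescale hc]
    simpa [Schedule.rescale, hc.ne'] using h.start_on_idle j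
  longest_first j i hp := by
    rw [Schedule.pending_rescale hc] at hp
    refine div_le_div_of_nonneg_right (h.longest_first j i ?_) hc.le
    simpa [Schedule.rescale, hc.ne'] using hp
  no_delay t hp M := by
    rw [Schedule.idleWrt_rescale hc]
    simp only [Schedule.pending_rescale hc] at hp
    exact h.no_delay _ hp M

end Rescale

/-- To compare an algorithm with the optimum it suffices to treat instances that have an offline
schedule of length `1`. -/
theorem makespan_le_mul_optMakespan [Finite ι] {lam α ρ : ℝ} (hρ : 0 ≤ ρ)
    (hunit : ∀ (J : JobSet ι) (σ τ : Schedule m ι), IsSleepySchedule lam α J σ →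
      τ.Feasible J → (∀ j, τ.completion J j ≤ 1) → ∀ j, σ.completion J j ≤ ρ)
    (J : JobSet ι) (σ : Schedule m ι) (hσ : IsSleepySchedule lam α J σ) :
    σ.makespan J ≤ ρ * optMakespan m J := by
  rcases isEmpty_or_nonempty ι with hι | hι
  · have h0 : ∀ τ : Schedule m ι, τ.makespan J = 0 := fun τ => by simp [Schedule.makespan]
    rw [h0, optMakespan]
    refine mul_nonneg hρ (Real.sInf_nonneg ?_)
    rintro x ⟨τ, -, rfl⟩
    rw [h0]
  have hle : ∀ (τ : Schedule m ι) j, τ.completion J j ≤ τ.makespan J := fun τ j =>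
    le_ciSup (f := τ.completion J) (Set.finite_range _).bddAbove j
  have key : ∀ τ : Schedule m ι, τ.Feasible J → σ.makespan J ≤ ρ * τ.makespan J := by
    intro τ hτ
    have hpos : 0 < τ.makespan J := by
      obtain ⟨j⟩ := hι
      have h1 := hle τ j
      have h2 := J.proc_pos j
      have h3 := J.release_nonneg j
      have h4 := hτ.release_le_start j
      unfold Schedule.completion at h1
      linarith
    refine ciSup_le fun j => ?_
    have := hunit _ _ _ (hσ.rescale hpos) (hτ.rescale hpos) (fun j => by
      rw [Schedule.completion_rescale, div_le_one hpos]
      exact hle τ j) j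
    rwa [Schedule.completion_rescale, div_le_iff₀ hpos] at this
  rcases hρ.eq_or_lt with rfl | hρ
  · simpa using key σ hσ.feasible
  · rw [mul_comm, ← div_le_iff₀ hρ]
    refine le_csInf ⟨_, σ, hσ.feasible, rfl⟩ ?_
    rintro x ⟨τ, hτ, rfl⟩
    rw [div_le_iff₀ hρ, mul_comm]
    exact key τ hτ

open MeasureTheory Set

/-! ### Overlaps of intervals as Lebesgue measure -/

/-- The length of the intersection of `[s, s + p)` and `[u, v)`. -/
noncomputable def overlap (s p u v : ℝ) : ℝ := max (min (s + p) v - max s u) 0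

lemma overlap_nonneg (s p u v : ℝ) : 0 ≤ overlap s p u v := le_max_right _ _

lemma overlap_eq_volume (s p u v : ℝ) :
    overlap s p u v = volume.real (Ico s (s + p) ∩ Ico u v) := by
  rw [Ico_inter_Ico, Real.volume_real_Ico, overlap]

lemma overlap_le {s p u v : ℝ} (hp : 0 ≤ p) : overlap s p u v ≤ p := by
  refine max_le ?_ hp
  have := min_le_left (s + p) v
  have := le_max_left s u
  linarith

lemma overlap_add {s p u v w : ℝ} (hp : 0 ≤ p) (huv : u ≤ v) (hvw : v ≤ w) :
    overlap s p u v + overlap s p v w = overlap s p u w := by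
  simp only [overlap, max_def, min_def]
  split_ifs <;> linarith

lemma overlap_eq_zero_of_le {s p u v : ℝ} (h : v ≤ s) : overlap s p u v = 0 := by
  refine max_eq_right ?_
  have := min_le_right (s + p) v
  have := le_max_left s u
  linarith

lemma overlap_eq_self {s p u v : ℝ} (hp : 0 ≤ p) (hu : u ≤ s) (hv : s + p ≤ v) :
    overlap s p u v = p := by
  rw [overlap, min_eq_left hv, max_eq_left hu, max_eq_left] <;> linarith

lemma overlap_eq_sub {s p u v : ℝ} (hu : u ≤ s) (hs : s ≤ v) (hv : v ≤ s + p) :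
    overlap s p u v = v - s := by
  rw [overlap, min_eq_right hv, max_eq_left hu, max_eq_left]; linarith

lemma sub_le_sum_overlap {κ : Type*} (F : Finset κ) (s p : κ → ℝ) {u v : ℝ}
    (h : ∀ t ∈ Ico u v, ∃ i ∈ F, t ∈ Ico (s i) (s i + p i)) :
    v - u ≤ ∑ i ∈ F, overlap (s i) (p i) u v := by
  have h1 : Ico u v = ⋃ i ∈ F, Ico (s i) (s i + p i) ∩ Ico u v := by
    ext t
    simp only [mem_iUnion, mem_inter_iff, exists_prop]
    exact ⟨fun ht => (h t ht).imp fun i hi => ⟨hi.1, hi.2, ht⟩, fun ⟨i, hi, _, ht⟩ => ht⟩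
  calc v - u ≤ volume.real (Ico u v) := by rw [Real.volume_real_Ico]; exact le_max_left _ _
    _ = volume.real (⋃ i ∈ F, Ico (s i) (s i + p i) ∩ Ico u v) := by rw [← h1]
    _ ≤ ∑ i ∈ F, volume.real (Ico (s i) (s i + p i) ∩ Ico u v) :=
        measureReal_biUnion_finset_le _ _
    _ = _ := Finset.sum_congr rfl fun i _ => (overlap_eq_volume _ _ _ _).symm

lemma sum_overlap_le {κ : Type*} (F : Finset κ) (s p : κ → ℝ) {u v : ℝ} (huv : u ≤ v)
    (h : ∀ i ∈ F, ∀ j ∈ F, i ≠ j → s i + p i ≤ s j ∨ s j + p j ≤ s i) :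
    ∑ i ∈ F, overlap (s i) (p i) u v ≤ v - u := by
  have hd : (F : Set κ).PairwiseDisjoint fun i => Ico (s i) (s i + p i) ∩ Ico u v := by
    intro i hi j hj hij
    refine Disjoint.mono inter_subset_left inter_subset_left ?_
    rw [Set.disjoint_left]
    rintro t ⟨h1, h2⟩ ⟨h3, h4⟩
    rcases h i hi j hj hij with h | h <;> linarith
  calc ∑ i ∈ F, overlap (s i) (p i) u v
      = ∑ i ∈ F, volume.real (Ico (s i) (s i + p i) ∩ Ico u v) :=
        Finset.sum_congr rfl fun i _ => overlap_eq_volume _ _ _ _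
    _ = volume.real (⋃ i ∈ F, Ico (s i) (s i + p i) ∩ Ico u v) :=
        (measureReal_biUnion_finset hd (fun i _ => measurableSet_Ico.inter measurableSet_Ico)
          (fun i _ => measure_ne_top_of_subset inter_subset_right (by simp))).symm
    _ ≤ volume.real (Ico u v) := measureReal_mono (by simp) (by simp)
    _ = v - u := by rw [Real.volume_real_Ico, max_eq_left (sub_nonneg.2 huv)]

/-! ### Work and lock time -/

section Work

variable [Fintype ι]

/-- The amount of processing done on machine `M` during `[u, v)`. -/
noncomputable def Schedule.machineWork (σ : Schedule m ι) (J : JobSet ι) (M : Fin m)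
    (u v : ℝ) : ℝ :=
  ∑ j with σ.machine j = M, overlap (σ.start j) (J.proc j) u v

/-- The amount of processing done on all machines during `[u, v)`. -/
noncomputable def Schedule.work (σ : Schedule m ι) (J : JobSet ι) (u v : ℝ) : ℝ :=
  ∑ j, overlap (σ.start j) (J.proc j) u v

/-- The total duration of locks during `[u, v)`. -/
noncomputable def Schedule.lockTime (σ : Schedule m ι) (J : JobSet ι) (lam α : ℝ)
    (u v : ℝ) : ℝ :=
  ∑ j, overlap (σ.start j) (σ.lock J lam α j) u v

lemma Schedule.sum_machineWork (σ : Schedule m ι) (J : JobSet ι) (u v : ℝ) :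
    ∑ M, σ.machineWork J M u v = σ.work J u v :=
  Finset.sum_fiberwise _ _ _

lemma Schedule.machineWork_nonneg (σ : Schedule m ι) (J : JobSet ι) (M : Fin m) (u v : ℝ) :
    0 ≤ σ.machineWork J M u v := Finset.sum_nonneg fun _ _ => overlap_nonneg _ _ _ _

lemma Schedule.machineWork_add (σ : Schedule m ι) (J : JobSet ι) (M : Fin m) {u v w : ℝ}
    (huv : u ≤ v) (hvw : v ≤ w) :
    σ.machineWork J M u v + σ.machineWork J M v w = σ.machineWork J M u w := by
  simp only [Schedule.machineWork, ← Finset.sum_add_distrib]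
  exact Finset.sum_congr rfl fun j _ => overlap_add (J.proc_pos j).le huv hvw

lemma Schedule.work_add (σ : Schedule m ι) (J : JobSet ι) {u v w : ℝ}
    (huv : u ≤ v) (hvw : v ≤ w) : σ.work J u v + σ.work J v w = σ.work J u w := by
  simp only [Schedule.work, ← Finset.sum_add_distrib]
  exact Finset.sum_congr rfl fun j _ => overlap_add (J.proc_pos j).le huv hvw

lemma Schedule.Feasible.machineWork_le {σ : Schedule m ι} {J : JobSet ι} (h : σ.Feasible J)
    (M : Fin m) {u v : ℝ} (huv : u ≤ v) : σ.machineWork J M u v ≤ v - u := by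
  refine sum_overlap_le _ _ _ huv fun i hi j hj hij => h.no_overlap i j hij ?_
  simp only [Finset.mem_filter, Finset.mem_univ, true_and] at hi hj
  rw [hi, hj]

lemma Schedule.Feasible.work_le {σ : Schedule m ι} {J : JobSet ι} (h : σ.Feasible J)
    {u v : ℝ} (huv : u ≤ v) : σ.work J u v ≤ m * (v - u) := by
  rw [← Schedule.sum_machineWork]
  calc _ ≤ ∑ _M : Fin m, (v - u) := Finset.sum_le_sum fun M _ => h.machineWork_le M huv
    _ = _ := by rw [Finset.sum_const, Finset.card_univ, Fintype.card_fin, nsmul_eq_mul]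

section Lock

variable {lam α : ℝ} (hlam : 0 < lam) (hα : 0 < α) (σ : Schedule m ι) (J : JobSet ι)

lemma Schedule.lockTime_nonneg (u v : ℝ) : 0 ≤ σ.lockTime J lam α u v :=
  Finset.sum_nonneg fun _ _ => overlap_nonneg _ _ _ _

include hlam hα

lemma Schedule.lockTime_add {u v w : ℝ} (huv : u ≤ v) (hvw : v ≤ w) :
    σ.lockTime J lam α u v + σ.lockTime J lam α v w = σ.lockTime J lam α u w := by
  simp only [Schedule.lockTime, ← Finset.sum_add_distrib]
  exact Finset.sum_congr rfl fun j _ => overlap_add (σ.lock_pos J hlam hα j).le huv hvw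

lemma Schedule.lockTime_le (u v : ℝ) : σ.lockTime J lam α u v ≤ ∑ j, σ.lock J lam α j :=
  Finset.sum_le_sum fun j _ => overlap_le (σ.lock_pos J hlam hα j).le

end Lock

/-- While a machine is never idle, it processes jobs or is locked. -/
lemma Schedule.sub_le_machineWork_add_lockTime (σ : Schedule m ι) (J : JobSet ι) {lam α : ℝ}
    {M : Fin m} {u v : ℝ} (h : ∀ t, u ≤ t → t < v → ¬ σ.IdleWrt J lam α univ M t) :
    v - u ≤ σ.machineWork J M u v + σ.lockTime J lam α u v := by
  -- Two copies of the jobs index the cover: one for processing intervals on `M`, one for lock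
  -- intervals.
  have := sub_le_sum_overlap
    ((Finset.univ.filter fun j => σ.machine j = M).disjSum (Finset.univ : Finset ι))
    (Sum.elim σ.start σ.start) (Sum.elim J.proc (σ.lock J lam α)) (u := u) (v := v) ?_
  · rwa [Finset.sum_disjSum] at this
  · intro t ht
    have h1 := h t ht.1 ht.2
    simp only [Schedule.IdleWrt, mem_univ, forall_const, not_forall] at h1
    obtain ⟨i, hi⟩ := h1
    rw [not_and_or, not_not, not_not] at hi
    rcases hi with hi | hi
    · exact ⟨Sum.inl i, by simp [hi.1], hi.2⟩
    · exact ⟨Sum.inr i, by simp, hi⟩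

/-- While no machine is ever idle, the loss of work is due to locks. -/
lemma Schedule.sub_le_work_add_lockTime (σ : Schedule m ι) (J : JobSet ι) {lam α : ℝ}
    {u v : ℝ} (h : ∀ t, u ≤ t → t < v → ∀ M, ¬ σ.IdleWrt J lam α univ M t) :
    m * (v - u) ≤ σ.work J u v + m * σ.lockTime J lam α u v := by
  have h1 : ∑ _M : Fin m, (v - u) ≤
      ∑ M, (σ.machineWork J M u v + σ.lockTime J lam α u v) :=
    Finset.sum_le_sum fun M _ =>
      σ.sub_le_machineWork_add_lockTime J fun t h1 h2 => h t h1 h2 M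
  simpa only [Finset.sum_add_distrib, Schedule.sum_machineWork, Finset.sum_const,
    Finset.card_univ, Fintype.card_fin, nsmul_eq_mul] using h1

end Work

section Basic

variable {lam α : ℝ} {J : JobSet ι} {σ : Schedule m ι}

lemma IsSleepySchedule.not_idle (h : IsSleepySchedule lam α J σ) {j : ι} {t : ℝ}
    (h1 : J.release j ≤ t) (h2 : t < σ.start j) (M : Fin m) :
    ¬ σ.IdleWrt J lam α univ M t := h.no_delay t ⟨j, h1, h2⟩ M

lemma IsSleepySchedule.start_add_lock_le (h : IsSleepySchedule lam α J σ) {i j : ι}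
    (hij : i ≠ j) (hle : σ.start i ≤ σ.start j) :
    σ.start i + σ.lock J lam α i ≤ σ.start j := by
  have := (h.start_on_idle j i (by simpa using hij)).2
  simp only [Schedule.LockedBy, not_and, not_lt] at this
  exact this hle

lemma not_idleWrt_of_processing {M : Fin m} {j : ι} {t : ℝ} (hM : σ.machine j = M)
    (h1 : σ.start j ≤ t) (h2 : t < σ.completion J j) : ¬ σ.IdleWrt J lam α univ M t :=
  fun h => (h j (mem_univ j)).1 ⟨hM, h1, h2⟩

lemma Schedule.Feasible.proc_le_one {τ : Schedule m ι} (hτ : τ.Feasible J)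
    (h1 : ∀ j, τ.completion J j ≤ 1) (j : ι) : J.release j + J.proc j ≤ 1 := by
  have := h1 j
  unfold Schedule.completion at this
  linarith [hτ.release_le_start j]

end Basic

/-! ### Backlog against an arbitrary feasible schedule -/

lemma overlap_le_sub_of_le {r s p u v : ℝ} (hrs : r ≤ s) (hrv : r ≤ v) :
    overlap s p u v ≤ v - r := by
  refine max_le ?_ (sub_nonneg.2 hrv)
  have := min_le_right (s + p) v
  have := le_max_left s u
  linarith

section Leftover

variable [Fintype ι] {lam α : ℝ} {J : JobSet ι} {σ τ : Schedule m ι}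

/-- If every job released before `t` is started before `t`, then any other schedule is ahead by
at most the waiting times of the jobs that are being processed at time `t`. -/
lemma work_sub_work_le_sum_waiting [DecidableEq ι] (hσ : σ.Feasible J) (hτ : τ.Feasible J)
    {t : ℝ} (hpend : ∀ j, J.release j < t → σ.start j < t) (X : Finset ι)
    (hX : ∀ j, j ∈ X ↔ σ.start j < t ∧ t < σ.completion J j) :
    τ.work J 0 t - σ.work J 0 t ≤ ∑ j ∈ X, (σ.start j - J.release j) := by
  rw [Schedule.work, Schedule.work, ← Finset.sum_sub_distrib, ← Finset.univ_inter X,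
    ← Finset.sum_ite_mem]
  refine Finset.sum_le_sum fun j _ => ?_
  have hr := J.release_nonneg j
  have hrs := hσ.release_le_start j
  have hrt := hτ.release_le_start j
  have hp := (J.proc_pos j).le
  have hσ0 := overlap_nonneg (σ.start j) (J.proc j) 0 t
  have hw : 0 ≤ if j ∈ X then σ.start j - J.release j else 0 := by
    split_ifs
    · exact sub_nonneg.2 hrs
    · exact le_rfl
  rcases le_or_gt t (J.release j) with h | h
  · rw [overlap_eq_zero_of_le (h.trans hrt)]
    linarith
  have hs := hpend j h
  -- On a completed job `τ` cannot be ahead; a running job has received `t - s_j`, against at most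
  -- `t - r_j` in `τ`.
  rcases le_or_gt (σ.completion J j) t with hc | hc
  · rw [overlap_eq_self (s := σ.start j) hp (hr.trans hrs) hc]
    have := overlap_le (s := τ.start j) (u := 0) (v := t) hp
    linarith
  · rw [if_pos ((hX j).2 ⟨hs, hc⟩), overlap_eq_sub (hr.trans hrs) hs.le hc.le]
    have := overlap_le_sub_of_le (p := J.proc j) (u := 0) hrt h.le
    linarith

/-- The work done while job `j` waits (by all machines) and is then processed (by its machine). -/
lemma IsSleepySchedule.le_work_of_crossing (hlam : 0 < lam) (hα : 0 < α)
    (h : IsSleepySchedule lam α J σ) {j : ι} {t : ℝ} (hs : σ.start j ≤ t)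
    (hc : t ≤ σ.completion J j) :
    m * (σ.start j - J.release j) + (t - σ.start j) ≤
      σ.work J (J.release j) t + m * σ.lockTime J lam α (J.release j) t := by
  have hrs := h.feasible.release_le_start j
  have hL := σ.lockTime_add hlam hα J hrs hs
  have hL0 := σ.lockTime_nonneg J (lam := lam) (α := α) (σ.start j) t
  have key : ∀ M : Fin m, (σ.start j - J.release j) +
      (if M = σ.machine j then t - σ.start j else 0) ≤
      σ.machineWork J M (J.release j) t + σ.lockTime J lam α (J.release j) t := by
    intro M
    split_ifs with hM
    · have := σ.sub_le_machineWork_add_lockTime J (lam := lam) (α := α) (M := M)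
        (u := J.release j) (v := t) fun x h1 h2 => by
          rcases lt_or_ge x (σ.start j) with h3 | h3
          · exact h.not_idle h1 h3 M
          · exact not_idleWrt_of_processing hM.symm h3 (h2.trans_le hc)
      linarith
    · have := σ.sub_le_machineWork_add_lockTime J (lam := lam) (α := α) (M := M)
        (u := J.release j) (v := σ.start j) fun x h1 h2 => h.not_idle h1 h2 M
      have := σ.machineWork_add J M hrs hs
      have := σ.machineWork_nonneg J M (σ.start j) t
      linarith
  have := Finset.sum_le_sum fun M (_ : M ∈ Finset.univ) => key M
  simpa only [Finset.sum_add_distrib, Schedule.sum_machineWork, Finset.sum_const,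
    Finset.card_univ, Fintype.card_fin, nsmul_eq_mul, Finset.sum_ite_eq', Finset.mem_univ,
    if_true] using this

/-- At a release time, the algorithm is behind any other schedule by a bounded amount of work. -/
theorem IsSleepySchedule.work_sub_work_le (hm : 1 ≤ m) (hlam : 0 < lam) (hα : 0 < α)
    (h : IsSleepySchedule lam α J σ) (hτ : τ.Feasible J) (i : ι) :
    τ.work J 0 (J.release i) - σ.work J 0 (J.release i) ≤
      m * (m - 1) / (2 * m - 1) * J.release i + m * σ.lockTime J lam α 0 (J.release i) := by
  classical
  by_contra hbad
  -- Choose a violation with earliest release, so that the bound holds at all earlier releases.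
  obtain ⟨i, hi, hmin⟩ := (Finset.univ.filter fun i =>
    ¬ τ.work J 0 (J.release i) - σ.work J 0 (J.release i) ≤
      m * (m - 1) / (2 * m - 1) * J.release i +
        m * σ.lockTime J lam α 0 (J.release i)).exists_min_image J.release ⟨i, by simpa using hbad⟩
  simp only [Finset.mem_filter, Finset.mem_univ, true_and] at hi hmin
  set t := J.release i with ht
  have hgood : ∀ j, J.release j < t → τ.work J 0 (J.release j) - σ.work J 0 (J.release j) ≤
      m * (m - 1) / (2 * m - 1) * J.release j +
        m * σ.lockTime J lam α 0 (J.release j) := fun j hj => by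
    by_contra hcon
    exact absurd (hmin j hcon) (not_le.2 hj)
  refine hi ?_
  have hmR : (1 : ℝ) ≤ m := by exact_mod_cast hm
  set C : ℝ := m * (m - 1) / (2 * m - 1) with hC
  have hC0 : 0 ≤ C := div_nonneg (mul_nonneg (by linarith) (by linarith)) (by linarith)
  have hCm : C * (2 * m - 1) = m * (m - 1) := by
    rw [hC, div_mul_cancel₀]; linarith
  have htn : 0 ≤ t := J.release_nonneg i
  have hL0 := σ.lockTime_nonneg J (lam := lam) (α := α) 0 t
  have hmL : 0 ≤ m * σ.lockTime J lam α 0 t := mul_nonneg (by linarith) hL0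
  by_cases hpend : ∀ j, J.release j < t → σ.start j < t
  · let X := Finset.univ.filter fun j => σ.start j < t ∧ t < σ.completion J j
    have hX : ∀ j, j ∈ X ↔ σ.start j < t ∧ t < σ.completion J j := fun j => by simp [X]
    have hD := work_sub_work_le_sum_waiting h.feasible hτ hpend X hX
    rcases X.eq_empty_or_nonempty with hXe | hXne
    · rw [hXe, Finset.sum_empty] at hD
      have := mul_nonneg hC0 htn
      linarith
    obtain ⟨j, hjX, hjmax⟩ := X.exists_max_image (fun j => σ.start j - J.release j) hXne
    have hcard : X.card ≤ m := by
      have := Finset.card_le_card_of_injOn (s := X) (t := (Finset.univ : Finset (Fin m))) σ.machine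
        (fun _ _ => by simp) fun a ha b hb hab => ?_
      · simpa using this
      · by_contra hne
        have ha' := (hX a).1 ha
        have hb' := (hX b).1 hb
        rcases h.feasible.no_overlap a b hne hab with h1 | h1 <;> linarith
    have hrs := h.feasible.release_le_start j
    have hjX' := (hX j).1 hjX
    set T := σ.start j - J.release j with hT
    have hT0 : 0 ≤ T := sub_nonneg.2 hrs
    have h1 : ∑ k ∈ X, (σ.start k - J.release k) ≤ m * T := by
      calc _ ≤ X.card • T := Finset.sum_le_card_nsmul _ _ _ hjmax
        _ = X.card * T := nsmul_eq_mul _ _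
        _ ≤ m * T := mul_le_mul_of_nonneg_right (by exact_mod_cast hcard) hT0
    have hrt : J.release j < t := hrs.trans_lt hjX'.1
    have hr0 := J.release_nonneg j
    have h2 := hgood j hrt
    have h3 := h.le_work_of_crossing hlam hα hjX'.1.le hjX'.2.le
    have h4 := τ.work_add J hr0 hrt.le
    have h5 := σ.work_add J hr0 hrt.le
    have h6 := hτ.work_le hrt.le
    have h7 := σ.lockTime_add hlam hα J hr0 hrt.le
    have h8 := congrArg (fun x => (m : ℝ) * x) h7
    simp only [mul_add] at h8
    have h9 := mul_nonneg hC0 hr0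
    set Y := τ.work J 0 t - σ.work J 0 t - m * σ.lockTime J lam α 0 t - C * J.release j with hY
    have hY1 : Y ≤ m * T := by linarith
    have hY2 : Y ≤ (m - 1) * (t - J.release j - T) := by
      have : t - σ.start j = t - J.release j - T := by rw [hT]; ring
      nlinarith
    have hY3 : Y ≤ C * (t - J.release j) := by
      have e1 := mul_le_mul_of_nonneg_left hY1 (by linarith : (0 : ℝ) ≤ m - 1)
      have e2 := mul_le_mul_of_nonneg_left hY2 (by linarith : (0 : ℝ) ≤ m)
      have e3 : (2 * m - 1) * Y ≤ (2 * m - 1) * (C * (t - J.release j)) := by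
        have : (2 * m - 1) * (C * (t - J.release j)) = m * (m - 1) * (t - J.release j) := by
          rw [← hCm]; ring
        rw [this]
        linarith
      exact le_of_mul_le_mul_left e3 (by linarith)
    linarith
  -- Some job is pending from `r_j` to `t`, so only locks add to the backlog in between.
  · push Not at hpend
    obtain ⟨j, hjt, hjs⟩ := hpend
    have hr0 := J.release_nonneg j
    have h2 := hgood j hjt
    have h3 := σ.sub_le_work_add_lockTime J (lam := lam) (α := α) (u := J.release j) (v := t)
      fun x e1 e2 => h.not_idle e1 (e2.trans_le hjs)
    have h4 := τ.work_add J hr0 hjt.le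
    have h5 := σ.work_add J hr0 hjt.le
    have h6 := hτ.work_le hjt.le
    have h7 := σ.lockTime_add hlam hα J hr0 hjt.le
    have h8 := congrArg (fun x => (m : ℝ) * x) h7
    simp only [mul_add] at h8
    have h9 := mul_le_mul_of_nonneg_left hjt.le hC0
    linarith

end Leftover

lemma Schedule.Feasible.lock_le {lam α : ℝ} {J : JobSet ι} {σ : Schedule m ι} (hlam : 1 ≤ lam) (hα : 0 < α) (hσ : σ.Feasible J) (j : ι) :
    σ.lock J lam α j ≤ α * J.proc j := by
  have h0 := (J.release_nonneg j).trans (hσ.release_le_start j)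
  have h1 : lam ^ (-(σ.start j / J.proc j)) ≤ 1 :=
    Real.rpow_le_one_of_one_le_of_nonpos hlam (neg_nonpos.2 (div_nonneg h0 (J.proc_pos j).le))
  have h2 := J.proc_pos j
  calc σ.lock J lam α j = lam ^ (-(σ.start j / J.proc j)) * (α * J.proc j) := by
        rw [Schedule.lock, Schedule.lockParam]; ring
    _ ≤ 1 * (α * J.proc j) := mul_le_mul_of_nonneg_right h1 (by positivity)
    _ = _ := one_mul _

/-! ### The final lock phase and the volume bound -/

section Tail

variable [Fintype ι] {lam α : ℝ} {J : JobSet ι} {σ τ : Schedule m ι}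

lemma Schedule.Feasible.work_eq_sum_proc (hτ : τ.Feasible J)
    (hopt : ∀ j, τ.completion J j ≤ 1) : τ.work J 0 1 = ∑ j, J.proc j :=
  Finset.sum_congr rfl fun j _ => overlap_eq_self (J.proc_pos j).le
    ((J.release_nonneg j).trans (hτ.release_le_start j)) (hopt j)

lemma Schedule.Feasible.sum_proc_le (hτ : τ.Feasible J)
    (hopt : ∀ j, τ.completion J j ≤ 1) : ∑ j, J.proc j ≤ m := by
  rw [← hτ.work_eq_sum_proc hopt]
  simpa using hτ.work_le (zero_le_one (α := ℝ))

/-- Just before a job `n` that waited long enough is started there is a phase `[z, s_n)` during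
which all machines are locked, and just before `z` all machines process jobs. -/
lemma IsSleepySchedule.exists_lock_phase (hlam : 0 < lam) (hα : 0 < α)
    (h : IsSleepySchedule lam α J σ) {n : ι}
    (hn : ∑ j, σ.lock J lam α j < σ.start n - J.release n) :
    ∃ z, J.release n < z ∧ z ≤ σ.start n ∧
      (∀ M, ∃ c, σ.machine c = M ∧ σ.start c < z ∧ z ≤ σ.completion J c) ∧
      σ.start n - z ≤ ∑ i with z ≤ σ.start i ∧ σ.start i < σ.start n, σ.lock J lam α i := by
  classical
  -- `z` is the earliest start from which locks cover everything up to `s_n`; `n` itself qualifies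
  -- vacuously.
  obtain ⟨i₀, hi₀, hmin⟩ := (Finset.univ.filter fun i => σ.start i ≤ σ.start n ∧
    ∀ t, σ.start i ≤ t → t < σ.start n → ∃ k, σ.LockedBy J lam α k t).exists_min_image σ.start
    ⟨n, by simpa using fun t h1 h2 => absurd h2 (not_lt.2 h1)⟩
  simp only [Finset.mem_filter, Finset.mem_univ, true_and] at hi₀ hmin
  obtain ⟨hzn, hlock⟩ := hi₀
  set z := σ.start i₀ with hz
  have hrz : J.release n < z := by
    have h1 := sub_le_sum_overlap Finset.univ σ.start (σ.lock J lam α) (u := z)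
      (v := σ.start n) fun t ht => by
        obtain ⟨k, hk⟩ := hlock t ht.1 ht.2
        exact ⟨k, Finset.mem_univ k, hk⟩
    have h2 := σ.lockTime_le hlam hα J z (σ.start n)
    unfold Schedule.lockTime at h2
    linarith
  refine ⟨z, hrz, hzn, fun M => ?_, ?_⟩
  -- At the last event before `z`, whatever blocks `M` lasts until `z`. A lock would extend the
  -- phase backwards, so it is a job.
  · let E : Finset ℝ := {J.release n} ∪ Finset.univ.image (σ.completion J) ∪
      Finset.univ.image (fun j => σ.start j + σ.lockParam J lam α j * J.proc j)
    have hne : (E.filter (· < z)).Nonempty := ⟨J.release n, by simp [E, hrz]⟩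
    have hle : ∀ x ∈ E, x < z → x ≤ (E.filter (· < z)).max' hne := fun x hx hxt =>
      Finset.le_max' _ _ (by simp [hx, hxt])
    obtain ⟨-, htz⟩ := Finset.mem_filter.1 ((E.filter (· < z)).max'_mem hne)
    set t := (E.filter (· < z)).max' hne
    have hrt : J.release n ≤ t := hle _ (by simp [E]) hrz
    have hbusy := h.not_idle hrt (htz.trans_le hzn) M
    simp only [Schedule.IdleWrt, mem_univ, forall_const, not_forall] at hbusy
    obtain ⟨i, hi⟩ := hbusy
    rw [not_and_or, not_not, not_not] at hi
    rcases hi with ⟨hM, hi⟩ | hi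
    · refine ⟨i, hM, hi.1.trans_lt htz, ?_⟩
      by_contra! hcon
      exact absurd (hle _ (by simp [E]) hcon) (not_le.2 hi.2)
    · have hend : z ≤ σ.start i + σ.lockParam J lam α i * J.proc i := by
        by_contra! hcon
        exact absurd (hle _ (by simp [E]) hcon) (not_le.2 hi.2)
      have hiz := hi.1.trans_lt htz
      refine absurd (hmin i ⟨hiz.le.trans hzn, fun x hx hxn => ?_⟩) (not_le.2 hiz)
      rcases lt_or_ge x z with hxz | hxz
      · exact ⟨i, hx, hxz.trans_le hend⟩
      · exact hlock x hxz hxn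
  · refine (sub_le_sum_overlap (Finset.univ.filter fun i => z ≤ σ.start i ∧
      σ.start i < σ.start n) σ.start (σ.lock J lam α) fun t ht => ?_).trans
      (Finset.sum_le_sum fun i _ => overlap_le (σ.lock_pos J hlam hα i).le)
    obtain ⟨k, hk⟩ := hlock t ht.1 ht.2
    refine ⟨k, ?_, hk⟩
    simp only [Finset.mem_filter, Finset.mem_univ, true_and]
    refine ⟨?_, hk.1.trans_lt ht.2⟩
    -- An earlier job whose lock reaches past `z` would have kept `i₀` from starting at `z`.
    by_contra! hcon
    have hne : k ≠ i₀ := fun e => by rw [e] at hcon; exact lt_irrefl _ hcon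
    exact (h.start_on_idle i₀ k (by simpa using hne)).2 ⟨hcon.le, ht.1.trans_lt hk.2⟩

/-- If `a` is started before `n` and is completed after the release of `n`, then all machines
work from the release of `a` until `n` is started, except between `s_a` and `r_n`. -/
lemma IsSleepySchedule.work_bound (hm : 1 ≤ m) (hlam : 0 < lam) (hα : 0 < α)
    (h : IsSleepySchedule lam α J σ) (hτ : τ.Feasible J) (hopt : ∀ j, τ.completion J j ≤ 1)
    {a n : ι} (han : σ.start a ≤ σ.start n) (hc : J.release n ≤ σ.completion J a) :
    m * (σ.start n - 1) + J.proc n - (m - 1) * max 0 (J.release n - σ.start a) ≤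
      m * (m - 1) / (2 * m - 1) * J.release a + m * ∑ j, σ.lock J lam α j := by
  classical
  set x := max 0 (J.release n - σ.start a) with hx
  have hx0 : 0 ≤ x := le_max_left _ _
  have hra := h.feasible.release_le_start a
  have hrn := h.feasible.release_le_start n
  have hra0 := J.release_nonneg a
  have hran := hra.trans han
  have key : ∀ M : Fin m, (σ.start n - J.release a - x) + (if M = σ.machine a then x else 0) ≤
      σ.machineWork J M (J.release a) (σ.start n) +
        σ.lockTime J lam α (J.release a) (σ.start n) := by
    intro M
    have full : (∀ t, J.release a ≤ t → t < σ.start n → ¬ σ.IdleWrt J lam α univ M t) →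
        (σ.start n - J.release a - x) + (if M = σ.machine a then x else 0) ≤
        σ.machineWork J M (J.release a) (σ.start n) +
          σ.lockTime J lam α (J.release a) (σ.start n) := fun hfull => by
      have := σ.sub_le_machineWork_add_lockTime J hfull
      split_ifs <;> linarith
    rcases le_or_gt (J.release n) (σ.start a) with hle | hlt
    · refine full fun t h1 h2 => ?_
      rcases lt_or_ge t (σ.start a) with h3 | h3
      · exact h.not_idle h1 h3 M
      · exact h.not_idle (hle.trans h3) h2 M
    by_cases hM : M = σ.machine a
    · refine full fun t h1 h2 => ?_
      rcases lt_or_ge t (σ.start a) with h3 | h3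
      · exact h.not_idle h1 h3 M
      rcases lt_or_ge t (J.release n) with h4 | h4
      · exact not_idleWrt_of_processing hM.symm h3 (h4.trans_le hc)
      · exact h.not_idle h4 h2 M
    -- The other machines surely work only while `a` or `n` is pending; the gap `[s_a, r_n)` of
    -- length `x` is given up.
    · rw [if_neg hM]
      have e1 := σ.sub_le_machineWork_add_lockTime J (lam := lam) (α := α) (M := M)
        fun t h1 h2 => h.not_idle (j := a) h1 h2 M
      have e2 := σ.sub_le_machineWork_add_lockTime J (lam := lam) (α := α) (M := M)
        fun t h1 h2 => h.not_idle (j := n) h1 h2 M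
      have e3 := σ.machineWork_add J M hra han
      have e4 := σ.machineWork_add J M hlt.le hrn
      have e5 := σ.machineWork_nonneg J M (σ.start a) (J.release n)
      have e6 := σ.lockTime_add hlam hα J hra han
      have e7 := σ.lockTime_add hlam hα J hlt.le hrn
      have e8 := σ.lockTime_nonneg J (lam := lam) (α := α) (σ.start a) (J.release n)
      have e9 : x = J.release n - σ.start a := max_eq_right (by linarith)
      linarith
  have h1 := Finset.sum_le_sum fun M (_ : M ∈ Finset.univ) => key M
  simp only [Finset.sum_add_distrib, Schedule.sum_machineWork, Finset.sum_const,
    Finset.card_univ, Fintype.card_fin, nsmul_eq_mul, Finset.sum_ite_eq', Finset.mem_univ,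
    if_true] at h1
  -- Nothing of `n` is processed before `s_n`, while `τ` finishes the whole load by time `1`.
  have h2 : σ.work J 0 (σ.start n) + J.proc n ≤ τ.work J 0 1 := by
    rw [hτ.work_eq_sum_proc hopt]
    have : J.proc n = ∑ j, if j = n then J.proc n else 0 := by simp
    rw [this, Schedule.work, ← Finset.sum_add_distrib]
    refine Finset.sum_le_sum fun j _ => ?_
    split_ifs with hj
    · rw [hj, overlap_eq_zero_of_le le_rfl, zero_add]
    · rw [add_zero]
      exact overlap_le (J.proc_pos j).le
  have hra1 : J.release a ≤ 1 := by
    have := hτ.proc_le_one hopt a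
    have := J.proc_pos a
    linarith
  have h3 := h.work_sub_work_le hm hlam hα hτ a
  have h4 := τ.work_add J hra0 hra1
  have h5 := σ.work_add J hra0 hran
  have h6 := hτ.work_le hra1
  have h7 := σ.lockTime_add hlam hα J hra0 hran
  have h8 := mul_le_mul_of_nonneg_left (σ.lockTime_le hlam hα J 0 (σ.start n))
    (Nat.cast_nonneg (α := ℝ) m)
  have h9 := congrArg (fun x => (m : ℝ) * x) h7
  simp only [mul_add] at h9
  linarith

end Tail

/-- Among `m + 1` jobs, two share a machine. -/
lemma Schedule.Feasible.exists_pair {J : JobSet ι} {τ : Schedule m ι} (hτ : τ.Feasible J)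
    (hopt : ∀ j, τ.completion J j ≤ 1) {c : Fin m → ι} {n : ι} (hc : c.Injective)
    (hn : ∀ M, c M ≠ n) {P : ι → Prop} (hPc : ∀ M, P (c M)) (hPn : P n) :
    ∃ a b, P a ∧ P b ∧ J.release a + J.proc a + J.proc b ≤ 1 := by
  let f : Option (Fin m) → ι := fun o => o.elim n c
  have hf : f.Injective := by
    rintro (_ | M) (_ | N) hMN
    · rfl
    · exact absurd hMN.symm (hn N)
    · exact absurd hMN (hn M)
    · exact congrArg some (hc hMN)
  have hP : ∀ o, P (f o) := by
    rintro (_ | M)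
    · exact hPn
    · exact hPc M
  obtain ⟨o, o', hne, heq⟩ := Fintype.exists_ne_map_eq_of_card_lt (fun o => τ.machine (f o))
    (by simp)
  have aux : ∀ a b, τ.completion J a ≤ τ.start b → J.release a + J.proc a + J.proc b ≤ 1 := by
    intro a b hab
    have h1 := hτ.release_le_start a
    have h2 := hopt b
    unfold Schedule.completion at hab h2
    linarith
  rcases hτ.no_overlap _ _ (hf.ne hne) heq with hab | hab
  · exact ⟨_, _, hP o, hP o', aux _ _ hab⟩
  · exact ⟨_, _, hP o', hP o, aux _ _ hab⟩

/-! ### Numerical contradictions -/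

section Arithmetic

/-- The exact value is `M/2 - 1/4 - 1/(4(2M - 1))`. In the short case the last term is the slack to
be compared with `M * g`, whence `g` of order `1/M²`. -/
lemma backlog_coefficient_le {M : ℝ} (hM : 4 ≤ M) :
    M * (M - 1) / (2 * M - 1) ≤ M / 2 - 1 / 4 - 1 / (8 * M) := by
  rw [div_le_iff₀ (by linarith)]
  have h0 : M ≠ 0 := by linarith
  have : (M / 2 - 1 / 4 - 1 / (8 * M)) * (2 * M - 1) = M * (M - 1) + 1 / (8 * M) := by
    field_simp
    ring
  rw [this]
  have : 0 < 1 / (8 * M) := by apply one_div_pos.2; linarith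
  linarith

/-- The volume bound is violated when the last job `n` is shorter than two jobs `a`, `b` with
`r + a + b ≤ 1`. -/
lemma volume_contradiction_of_short {M s n x r a b g h : ℝ} (hM : 4 ≤ M) (hg0 : 0 ≤ g)
    (hg : g * (100000 * M ^ 2) ≤ 1) (hh : h * (4 * M) ≤ 1)
    (hs : 3 / 2 - g - n ≤ s) (hr : 0 ≤ r) (hab : r + a + b ≤ 1)
    (hna : n ≤ a) (hnb : n ≤ b) (hn : 0 < n)
    (hx0 : 0 ≤ x) (hx : x ≤ max 0 (a - 1 / 2 + (g + h)))
    (hvol : M * (s - 1) + n - (M - 1) * x ≤ M * (M - 1) / (2 * M - 1) * r + 1 / 4) : False := by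
  have hC := backlog_coefficient_le hM
  have hC0 : 0 ≤ M * (M - 1) / (2 * M - 1) :=
    div_nonneg (mul_nonneg (by linarith) (by linarith)) (by linarith)
  set C := M * (M - 1) / (2 * M - 1)
  have hMpos : 0 < M := by linarith
  set y := 1 / (8 * M) with hy
  have hyM : y * M = 1 / 8 := by rw [hy]; field_simp
  have hy0 : 0 < y := by rw [hy]; positivity
  have hy1 : y ≤ 1 / 32 := by nlinarith
  have hgM : M * g ≤ y / 1000 := by
    have : M * (M * g) ≤ M * (y / 1000) := by nlinarith
    exact le_of_mul_le_mul_left this hMpos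
  have hMs := mul_le_mul_of_nonneg_left hs hMpos.le
  rcases hx0.eq_or_lt with rfl | hxpos
  -- Without a gap, `r ≤ 1 - 2n` reduces the volume bound to `y ≤ M * g`.
  · have h1 : C * r ≤ C * (1 - 2 * n) := mul_le_mul_of_nonneg_left (by linarith) hC0
    have h2 : C * (1 - 2 * n) ≤ (M / 2 - 1 / 4 - y) * (1 - 2 * n) :=
      mul_le_mul_of_nonneg_right hC (by linarith)
    nlinarith
  · have hxa : x ≤ a - 1 / 2 + (g + h) := by
      rcases le_max_iff.1 hx with h | h
      · linarith
      · exact h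
    have hMh : M * h ≤ 1 / 4 := by linarith
    have h3 : C * r ≤ (M / 2 - 1 / 4 - y) * (1 / 2 - x - n + (g + h)) := by
      refine (mul_le_mul_of_nonneg_left (by linarith) hC0).trans
        (mul_le_mul_of_nonneg_right hC (by linarith))
    -- The second factor bounds `r` from above. Dropping this product from the volume bound leaves
    -- `1/4 + g ≤ (M - 1) * h + 2 * M * g`, whereas `h ≤ 2y` gives `(M - 1) * h ≤ 1/4 - 2y`.
    have h4 : 0 ≤ (M / 2 - 3 / 4 + y) * (1 / 2 - x - n + (g + h)) :=
      mul_nonneg (by linarith) (by linarith)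
    have h5 : h ≤ 1 / 16 := by nlinarith
    have h6 : y = M * (8 * y ^ 2) := by nlinarith
    have h7 : h * M ≤ 2 * y * M := by rw [mul_assoc, hyM]; linarith
    have h8 : h ≤ 2 * y := le_of_mul_le_mul_right h7 hMpos
    nlinarith

/-- The volume bound is violated when the last job has length about `1 / 2`, and two other jobs
of length about `1 / 2` are released early. -/
lemma volume_contradiction_of_medium {M s n x r a b g h : ℝ} (hM : 4 ≤ M) (hg0 : 0 ≤ g)
    (hg : g * (100000 * M ^ 2) ≤ 1) (hh0 : 0 ≤ h) (hh : h * (1024 * M) ≤ 1)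
    (hs : 3 / 2 - g - n ≤ s) (hr : 0 ≤ r) (hab : r + a + b ≤ 1)
    (ha : 1 / 2 - (g + h) ≤ a) (hb : 1 / 2 - (g + h) ≤ b) (hn : n ≤ 1 / 2 + (g + h))
    (hx : x ≤ max 0 (a - 1 / 2 + (g + h)))
    (hvol : M * (s - 1) + n - (M - 1) * x ≤ M * (M - 1) / (2 * M - 1) * r + 1 / 4) : False := by
  have hC := backlog_coefficient_le hM
  have hMpos : 0 < M := by linarith
  have hy : 0 < 1 / (8 * M) := by positivity
  have hgM : M * g ≤ 1 / 1000 := by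
    have : M * (M * g) ≤ M * (1 / 1000) := by nlinarith
    exact le_of_mul_le_mul_left this hMpos
  have hMs := mul_le_mul_of_nonneg_left hs hMpos.le
  have hMh : M * h ≤ 1 / 1024 := by linarith
  have hx' : x ≤ 2 * (g + h) := hx.trans (max_le (by linarith) (by linarith))
  have h1 := mul_le_mul_of_nonneg_left hx' (by linarith : 0 ≤ M - 1)
  have h2 := mul_le_mul_of_nonneg_left hn (by linarith : 0 ≤ M - 1)
  have h3 : M * (M - 1) / (2 * M - 1) * r ≤ M / 2 * (2 * (g + h)) :=
    mul_le_mul (by linarith) (by linarith) hr (by linarith)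
  -- Up to multiples of `M * g` and `M * h`, the bound now reads `1/2 ≤ 1/4`.
  nlinarith

/-- A job that is started at the end of the schedule has a larger ratio `s / p` than a job of
length about `1 / 2` that is started just before the release of the last job `n`. -/
lemma ratio_add_quarter_le {g h n z s₁ p₁ s₂ p₂ : ℝ} (hg : g ≤ 1 / 10000)
    (hh : h ≤ 1 / 16) (hn1 : n ≤ 1) (hz : 3 / 2 - g - n - h ≤ z)
    (hs₁ : z ≤ s₁) (hp₁0 : 0 < p₁) (hp₁ : p₁ ≤ n + h) (hs₂ : s₂ ≤ 1 - n)
    (hp₂ : 1 / 2 - (g + h) ≤ p₂) : s₂ / p₂ + 1 / 4 ≤ s₁ / p₁ := by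
  set q := n + h with hq
  have h1 : s₂ / p₂ ≤ (17 / 16 - q) / (4374 / 10000) :=
    div_le_div₀ (by linarith) (by linarith) (by norm_num) (by linarith)
  have h2 : (14999 / 10000 - q) / q ≤ s₁ / p₁ :=
    div_le_div₀ (by linarith) (by linarith) hp₁0 hp₁
  have h3 : (17 / 16 - q) / (4374 / 10000) + 1 / 4 ≤ (14999 / 10000 - q) / q := by
    rw [le_div_iff₀ (by linarith)]
    -- The difference is a quadratic in `q` whose minimum, near `0.805`, is positive.
    nlinarith [sq_nonneg (q - 805 / 1000)]
  linarith

end Arithmetic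

/-! ### Effect of dynamic locking on lock lengths -/

section LockLength

variable {lam α : ℝ} {J : JobSet ι} {σ : Schedule m ι}

lemma Schedule.lock_eq (σ : Schedule m ι) (J : JobSet ι) (lam α : ℝ) (j : ι) :
    σ.lock J lam α j = α * (J.proc j * lam ^ (-(σ.start j / J.proc j))) := by
  rw [Schedule.lock, Schedule.lockParam]; ring

/-- Since `lam ^ (1/4) ≥ 4`, a gap of `1/4` between the ratios start/length outweighs a factor `4`
between the lengths. -/
lemma Schedule.lock_le_lock_of_ratio (hlam : 256 ≤ lam) (hα : 0 < α) {i c : ι}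
    (hp : J.proc i ≤ 4 * J.proc c)
    (hr : σ.start c / J.proc c + 1 / 4 ≤ σ.start i / J.proc i) :
    σ.lock J lam α i ≤ σ.lock J lam α c := by
  rw [Schedule.lock_eq, Schedule.lock_eq]
  refine mul_le_mul_of_nonneg_left ?_ hα.le
  have hpos : 0 < lam := by linarith
  have h4 : (4 : ℝ) ≤ lam ^ (1 / 4 : ℝ) := by
    calc (4 : ℝ) = (256 : ℝ) ^ (1 / 4 : ℝ) := by
          rw [show (256 : ℝ) = 4 ^ (4 : ℝ) by norm_num, ← Real.rpow_mul (by norm_num)]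
          norm_num
      _ ≤ _ := Real.rpow_le_rpow (by norm_num) hlam (by norm_num)
  have h1 : lam ^ (-(σ.start i / J.proc i)) * lam ^ (1 / 4 : ℝ) ≤
      lam ^ (-(σ.start c / J.proc c)) := by
    rw [← Real.rpow_add hpos]
    exact Real.rpow_le_rpow_of_exponent_le (by linarith) (by linarith)
  have h2 : 0 < lam ^ (-(σ.start i / J.proc i)) := Real.rpow_pos_of_pos hpos _
  have h3 : 0 < lam ^ (-(σ.start c / J.proc c)) := Real.rpow_pos_of_pos hpos _
  have h5 := J.proc_pos i
  have h6 := J.proc_pos c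
  calc J.proc i * lam ^ (-(σ.start i / J.proc i))
      ≤ (4 * J.proc c) * lam ^ (-(σ.start i / J.proc i)) := mul_le_mul_of_nonneg_right hp h2.le
    _ = J.proc c * (lam ^ (-(σ.start i / J.proc i)) * 4) := by ring
    _ ≤ J.proc c * (lam ^ (-(σ.start i / J.proc i)) * lam ^ (1 / 4 : ℝ)) := by gcongr
    _ ≤ _ := mul_le_mul_of_nonneg_left h1 h6.le

/-- This damping keeps the final lock phase short when `n` has length about `1/2`. -/
lemma Schedule.lock_le_of_proc_le_start (hlam : 256 ≤ lam) (hα : 0 < α) {i : ι}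
    (hs : J.proc i ≤ σ.start i) : σ.lock J lam α i ≤ α / 256 * J.proc i := by
  have hpos : 0 < lam := by linarith
  have hp := J.proc_pos i
  have h1 : lam ^ (-(σ.start i / J.proc i)) ≤ 1 / 256 := by
    calc _ ≤ lam ^ (-1 : ℝ) := Real.rpow_le_rpow_of_exponent_le (by linarith)
          (neg_le_neg ((one_le_div hp).2 hs))
      _ = 1 / lam := by rw [Real.rpow_neg_one, one_div]
      _ ≤ _ := one_div_le_one_div_of_le (by norm_num) hlam
  rw [Schedule.lock_eq]
  calc _ ≤ α * (J.proc i * (1 / 256)) := by gcongr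
    _ = _ := by ring

/-- This limits `lam` from above: locks of early jobs must still exceed `2 * g`. -/
lemma Schedule.le_lock_of_ratio_le (hlam : 1 ≤ lam) (hlam' : lam ^ (6 / 5 : ℝ) ≤ 1024)
    (hα : 0 < α) {c : ι} (hr : σ.start c / J.proc c ≤ 6 / 5) :
    α / 1024 * J.proc c ≤ σ.lock J lam α c := by
  have hpos : 0 < lam := by linarith
  have hp := J.proc_pos c
  have h1 : 1 / 1024 ≤ lam ^ (-(σ.start c / J.proc c)) := by
    calc (1 / 1024 : ℝ) ≤ 1 / lam ^ (6 / 5 : ℝ) :=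
          one_div_le_one_div_of_le (Real.rpow_pos_of_pos hpos _) hlam'
      _ = lam ^ (-(6 / 5) : ℝ) := by rw [Real.rpow_neg hpos.le, one_div]
      _ ≤ _ := Real.rpow_le_rpow_of_exponent_le hlam (by linarith)
  rw [Schedule.lock_eq]
  calc _ = α * (J.proc c * (1 / 1024)) := by ring
    _ ≤ _ := by gcongr

end LockLength

/-! ### Counting jobs of length about `1/2` -/

/-- Jobs of length at least `1 / 2 - b` that are processed by one machine in time `1`: at most two
of them, and only one if one is longer than `1 / 2 + b`. -/
lemma sum_weight_le_two {F : Finset ι} {p : ι → ℝ} {b : ℝ} (hb : b < 1 / 6)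
    (hsum : ∑ j ∈ F, p j ≤ 1) (hlow : ∀ j ∈ F, 1 / 2 - b ≤ p j) :
    (∑ j ∈ F, if p j ≤ 1 / 2 + b then 1 else 2) ≤ 2 := by
  classical
  have hp0 : ∀ j ∈ F, 0 ≤ p j := fun j hj => by linarith [hlow j hj]
  by_cases hlong : ∃ j ∈ F, 1 / 2 + b < p j
  · obtain ⟨j, hj, hjb⟩ := hlong
    have hF : F = {j} := by
      refine Finset.eq_singleton_iff_unique_mem.2 ⟨hj, fun i hi => ?_⟩
      by_contra hij
      have h1 := Finset.sum_le_sum_of_subset_of_nonneg (f := p)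
        (Finset.insert_subset hi (Finset.singleton_subset_iff.2 hj)) fun k hk _ => hp0 k hk
      rw [Finset.sum_pair hij] at h1
      linarith [hlow i hi]
    rw [hF, Finset.sum_singleton]
    split_ifs <;> norm_num
  · push Not at hlong
    rw [Finset.sum_congr rfl fun j hj => if_pos (hlong j hj), Finset.sum_const, smul_eq_mul,
      mul_one]
    by_contra! hcard
    have h1 := Finset.card_nsmul_le_sum F p _ hlow
    have h2 : (3 : ℝ) ≤ F.card := by exact_mod_cast hcard
    rw [nsmul_eq_mul] at h1
    nlinarith

/-- Among `m + k` jobs of length at least `1 / 2 - b` there are `2 k` of length at most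
`1 / 2 + b`. -/
lemma Schedule.Feasible.card_short_jobs [Fintype ι] {J : JobSet ι} {τ : Schedule m ι}
    (hτ : τ.Feasible J) (hopt : ∀ j, τ.completion J j ≤ 1) {b : ℝ} (hb : b < 1 / 6)
    (S : Finset ι) (hS : ∀ j ∈ S, 1 / 2 - b ≤ J.proc j) :
    2 * S.card ≤ 2 * m + (S.filter fun j => J.proc j ≤ 1 / 2 + b).card := by
  classical
  have h1 : ∑ j ∈ S, (if J.proc j ≤ 1 / 2 + b then 1 else 2) ≤ 2 * m := by
    rw [← Finset.sum_fiberwise S τ.machine]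
    calc _ ≤ ∑ _M : Fin m, 2 := Finset.sum_le_sum fun M _ => ?_
      _ = 2 * m := by simp [mul_comm]
    refine sum_weight_le_two hb ?_ fun j hj => hS j (Finset.mem_filter.1 hj).1
    calc _ ≤ ∑ j with τ.machine j = M, J.proc j :=
          Finset.sum_le_sum_of_subset_of_nonneg
            (Finset.filter_subset_filter _ (Finset.subset_univ S)) fun j _ _ => (J.proc_pos j).le
      _ = τ.machineWork J M 0 1 := (Finset.sum_congr rfl fun j _ => overlap_eq_self
          (J.proc_pos j).le ((J.release_nonneg j).trans (hτ.release_le_start j)) (hopt j)).symm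
      _ ≤ 1 := by simpa using hτ.machineWork_le M (zero_le_one (α := ℝ))
  -- Each job's weight plus its indicator of being short is `2`.
  have h2 : ∑ j ∈ S, (if J.proc j ≤ 1 / 2 + b then 1 else 2) +
      (S.filter fun j => J.proc j ≤ 1 / 2 + b).card = 2 * S.card := by
    rw [Finset.card_filter, ← Finset.sum_add_distrib, mul_comm, ← smul_eq_mul,
      ← Finset.sum_const]
    refine Finset.sum_congr rfl fun j _ => ?_
    split_ifs <;> rfl
  omega

/-- Locks separate the starts of jobs. -/
lemma IsSleepySchedule.card_mul_le {lam α : ℝ} {J : JobSet ι} {σ : Schedule m ι}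
    (h : IsSleepySchedule lam α J σ) {P : Finset ι} {l A B : ℝ} (hl : 0 ≤ l) (hAB : A ≤ B)
    (hP : ∀ j ∈ P, A ≤ σ.start j ∧ σ.start j ≤ B ∧ l ≤ σ.lock J lam α j) :
    P.card * l ≤ B - A + l := by
  have h1 := sum_overlap_le P σ.start (fun _ => l) (u := A) (v := B + l) (by linarith)
    fun i hi j hj hij => by
      rcases le_total (σ.start i) (σ.start j) with hle | hle
      · have := h.start_add_lock_le hij hle
        have := (hP i hi).2.2
        left; linarith
      · have := h.start_add_lock_le hij.symm hle
        have := (hP j hj).2.2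
        right; linarith
  rw [Finset.sum_congr rfl fun j hj => overlap_eq_self hl (hP j hj).1 (by
    have := (hP j hj).2.1; linarith), Finset.sum_const, nsmul_eq_mul] at h1
  linarith

/-- If `m` long jobs are processed just before the lock phase `[z, s_n)` and the last job `n` is
longer than `1 / 2 + (g + h)`, then too many jobs of length about `1 / 2` have been started just
before the release of `n`: the locks do not permit this. -/
lemma IsSleepySchedule.false_of_long [Fintype ι] {lam α : ℝ} {J : JobSet ι}
    {σ τ : Schedule m ι} (h : IsSleepySchedule lam α J σ) (hτ : τ.Feasible J)
    (hopt : ∀ j, τ.completion J j ≤ 1) {n : ι} {z g b : ℝ} {c : Fin m → ι} {F : Finset ι}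
    (hb0 : 0 ≤ b) (hb : b < 1 / 6) (hn : 1 / 2 + b < J.proc n) (hzn : z ≤ σ.start n)
    (hc : c.Injective) (hcz : ∀ M, σ.start (c M) < z ∧ z ≤ σ.completion J (c M))
    (hclong : ∀ M, 1 / 2 - b ≤ J.proc (c M))
    (hcn : ∀ M, J.release n ≤ σ.start (c M) → J.proc n ≤ J.proc (c M))
    (hF : ∀ i ∈ F, z ≤ σ.start i ∧ σ.start i < σ.start n ∧ J.proc n ≤ J.proc i)
    (hgap : J.release n - z + 1 / 2 ≤ g + ∑ i ∈ F, σ.lock J lam α i)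
    (hbg : b ≤ g + ∑ i ∈ F, σ.lock J lam α i)
    (hlock : ∀ j, σ.start j < J.release n → z ≤ σ.completion J j → 1 / 2 - b ≤ J.proc j →
      2 * g < σ.lock J lam α j ∧ ∀ i ∈ F, σ.lock J lam α i ≤ σ.lock J lam α j)
    (hg : 0 ≤ g) : False := by
  classical
  have hnF : n ∉ F := fun hnF => lt_irrefl _ (hF n hnF).2.1
  have hdisj : Disjoint (Finset.univ.image c) (insert n F) := by
    rw [Finset.disjoint_left]
    intro j hj hj'
    obtain ⟨M, -, rfl⟩ := Finset.mem_image.1 hj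
    have h1 := (hcz M).1
    rcases Finset.mem_insert.1 hj' with h2 | h2
    · rw [h2] at h1; linarith
    · linarith [(hF _ h2).1]
  set S := Finset.univ.image c ∪ insert n F with hS
  have hScard : S.card = m + (F.card + 1) := by
    rw [hS, Finset.card_union_of_disjoint hdisj, Finset.card_image_of_injective _ hc,
      Finset.card_insert_of_notMem hnF, Finset.card_univ, Fintype.card_fin]
  have hlate : ∀ j ∈ insert n F, J.proc n ≤ J.proc j := by
    intro j hj
    rcases Finset.mem_insert.1 hj with rfl | hj
    · exact le_rfl
    · exact (hF j hj).2.2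
  have hnlow : 1 / 2 - b ≤ J.proc n := by linarith
  have hSlow : ∀ j ∈ S, 1 / 2 - b ≤ J.proc j := by
    intro j hj
    rcases Finset.mem_union.1 hj with hj | hj
    · obtain ⟨M, -, rfl⟩ := Finset.mem_image.1 hj
      exact hclong M
    · exact hnlow.trans (hlate j hj)
  have hcard := hτ.card_short_jobs hopt hb S hSlow
  set P := S.filter fun j => J.proc j ≤ 1 / 2 + b with hP
  have hPprop : ∀ j ∈ P, σ.start j < J.release n ∧ z ≤ σ.completion J j ∧
      1 / 2 - b ≤ J.proc j ∧ J.proc j ≤ 1 / 2 + b := by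
    intro j hj
    obtain ⟨hjS, hjb⟩ := Finset.mem_filter.1 hj
    rcases Finset.mem_union.1 hjS with hj' | hj'
    · obtain ⟨M, -, rfl⟩ := Finset.mem_image.1 hj'
      refine ⟨?_, (hcz M).2, hclong M, hjb⟩
      by_contra! hcon
      linarith [hcn M hcon]
    · linarith [hlate j hj']
  have hPcard : 2 * (F.card + 1) ≤ P.card := by omega
  obtain ⟨j, hjP, hjmin⟩ := P.exists_min_image (σ.lock J lam α)
    (Finset.card_pos.1 (by omega))
  obtain ⟨hj1, hj2, hj3, hj4⟩ := hPprop j hjP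
  obtain ⟨hjg, hjF⟩ := hlock j hj1 hj2 hj3
  set l := σ.lock J lam α j
  have hsum : ∑ i ∈ F, σ.lock J lam α i ≤ F.card * l := by
    rw [← nsmul_eq_mul]
    exact Finset.sum_le_card_nsmul _ _ _ hjF
  have hstart : ∀ i ∈ P, z - 1 / 2 - b ≤ σ.start i := by
    intro i hi
    obtain ⟨-, h2, -, h4⟩ := hPprop i hi
    unfold Schedule.completion at h2
    linarith
  -- The window has length at most `2 * (g + |F| * l)`, so `2 * (|F| + 1) * l ≤ 2 * g + 2 * |F| * l
  -- + l`, against `2 * g < l`.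
  have hspread := h.card_mul_le (P := P) (l := l) (A := z - 1 / 2 - b) (B := J.release n)
    (by linarith) ((hstart j hjP).trans hj1.le) fun i hi =>
      ⟨hstart i hi, (hPprop i hi).1.le, hjmin i hi⟩
  have hPcard' : (2 * (F.card + 1) : ℝ) ≤ P.card := by exact_mod_cast hPcard
  have := mul_le_mul_of_nonneg_right hPcard' (by linarith : 0 ≤ l)
  linarith

/-! ### The three cases for the last job -/

/-- If there is an offline schedule of length `1`, the algorithm needs at most `3 / 2 - g`. -/
theorem IsSleepySchedule.completion_le [Finite ι] (hm : 4 ≤ m) {lam g : ℝ} (hlam : 256 ≤ lam)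
    (hlam' : lam ^ (6 / 5 : ℝ) ≤ 1024) (hg0 : 0 ≤ g) (hg : g * (100000 * (m : ℝ) ^ 2) ≤ 1)
    {J : JobSet ι} {σ τ : Schedule m ι} (h : IsSleepySchedule lam (1 / (4 * (m : ℝ) ^ 2)) J σ)
    (hτ : τ.Feasible J) (hopt : ∀ j, τ.completion J j ≤ 1) (j : ι) :
    σ.completion J j ≤ 3 / 2 - g := by
  classical
  cases nonempty_fintype ι
  by_contra! hj
  obtain ⟨n, -, hmax⟩ := Finset.univ.exists_max_image (σ.completion J) ⟨j, Finset.mem_univ j⟩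
  replace hmax : ∀ i, σ.start i + J.proc i ≤ σ.start n + J.proc n :=
    fun i => hmax i (Finset.mem_univ i)
  have hn : 3 / 2 - g - J.proc n < σ.start n := by
    have := hmax j
    unfold Schedule.completion at hj
    linarith
  have hM : (4 : ℝ) ≤ m := by exact_mod_cast hm
  have hMpos : (0 : ℝ) < m := by linarith
  set α : ℝ := 1 / (4 * (m : ℝ) ^ 2) with hαdef
  have hα : 0 < α := by positivity
  have hαm : α * m = 1 / (4 * m) := by rw [hαdef]; field_simp
  have hαg : α * (m : ℝ) ^ 2 = 1 / 4 := by rw [hαdef]; field_simp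
  have hlam0 : 0 < lam := by linarith
  have hproc := hτ.sum_proc_le hopt
  have hgs : g ≤ 1 / 1600000 := by
    have h16 : (16 : ℝ) ≤ (m : ℝ) ^ 2 := by nlinarith
    linarith [mul_le_mul_of_nonneg_left h16 hg0]
  have hlocks : ∑ i, σ.lock J lam α i ≤ 1 / (4 * m) := by
    calc _ ≤ ∑ i, α * J.proc i := Finset.sum_le_sum fun i _ =>
          h.feasible.lock_le (by linarith) hα i
      _ = α * ∑ i, J.proc i := (Finset.mul_sum _ _ _).symm
      _ ≤ α * m := mul_le_mul_of_nonneg_left hproc hα.le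
      _ = _ := hαm
  have hinv : 1 / (4 * (m : ℝ)) ≤ 1 / 16 := one_div_le_one_div_of_le (by norm_num) (by linarith)
  have hmlocks : m * ∑ i, σ.lock J lam α i ≤ 1 / 4 := by
    calc _ ≤ m * (1 / (4 * (m : ℝ))) := mul_le_mul_of_nonneg_left hlocks hMpos.le
      _ = _ := by field_simp
  have hrn := hτ.proc_le_one hopt n
  have hrn0 := J.release_nonneg n
  obtain ⟨z, hrz, hzn, hzM, hz⟩ := h.exists_lock_phase hlam0 hα (n := n) (by linarith)
  choose c hcM hcz using hzM
  set F := Finset.univ.filter fun i => z ≤ σ.start i ∧ σ.start i < σ.start n with hF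
  obtain ⟨d, hd⟩ : ∃ d, d = σ.start n - z := ⟨_, rfl⟩
  have hd0 : 0 ≤ d := by linarith
  have hFall : ∑ i ∈ F, σ.lock J lam α i ≤ ∑ i, σ.lock J lam α i :=
    Finset.sum_le_univ_sum_of_nonneg fun i => (σ.lock_pos J hlam0 hα i).le
  have hdm : d ≤ 1 / (4 * m) := by linarith
  have hdm' : d * (4 * m) ≤ 1 := by rwa [le_div_iff₀ (by positivity)] at hdm
  have hFprop : ∀ i ∈ F, z ≤ σ.start i ∧ σ.start i < σ.start n ∧ J.proc n ≤ J.proc i := by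
    intro i hi
    simp only [hF, Finset.mem_filter, Finset.mem_univ, true_and] at hi
    exact ⟨hi.1, hi.2, h.longest_first i n ⟨by linarith, hi.2⟩⟩
  have hFproc : ∀ i ∈ F, J.proc i ≤ J.proc n + d := fun i hi => by
    have := hmax i
    have := (hFprop i hi).1
    linarith
  -- This property is shared by `n` and the jobs running at `z`, so whichever pair shares a machine
  -- in `τ` has it.
  let Late : ι → Prop := fun i => σ.start i ≤ σ.start n ∧ z ≤ σ.completion J i ∧
    (J.proc n ≤ J.proc i ∨ σ.start i < J.release n ∧ 1 / 2 - (g + d) ≤ J.proc i)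
  have hLc : ∀ M, Late (c M) := by
    intro M
    obtain ⟨h1, h2⟩ := hcz M
    refine ⟨by linarith, h2, ?_⟩
    rcases le_or_gt (J.release n) (σ.start (c M)) with h3 | h3
    · exact Or.inl (h.longest_first _ n ⟨h3, by linarith⟩)
    · right
      unfold Schedule.completion at h2
      exact ⟨h3, by linarith⟩
  have hLn : Late n := by
    refine ⟨le_rfl, ?_, Or.inl le_rfl⟩
    have := J.proc_pos n
    unfold Schedule.completion
    linarith
  have hcinj : c.Injective := fun M N hMN => by rw [← hcM M, ← hcM N, hMN]
  have hcn : ∀ M, c M ≠ n := fun M e => by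
    have := (hcz M).1
    rw [e] at this
    linarith
  obtain ⟨a, b, hLa, hLb, hab⟩ := hτ.exists_pair hopt hcinj hcn hLc hLn
  have hvol := h.work_bound (by omega) hlam0 hα hτ hopt hLa.1 (hrz.le.trans hLa.2.1)
  have hra0 := J.release_nonneg a
  have hx : max 0 (J.release n - σ.start a) ≤ max 0 (J.proc a - 1 / 2 + (g + d)) := by
    refine max_le_max le_rfl ?_
    have := hLa.2.1
    unfold Schedule.completion at this
    linarith
  rcases le_or_gt (J.proc n) (1 / 2 - (g + d)) with hshort | hshort
  · have hle : ∀ i, Late i → J.proc n ≤ J.proc i := fun i hi => by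
      rcases hi.2.2 with h1 | h1
      · exact h1
      · linarith [h1.2]
    exact volume_contradiction_of_short hM hg0 hg hdm' hn.le hra0 hab (hle a hLa) (hle b hLb)
      (J.proc_pos n) (le_max_left _ _) hx (by linarith)
  have hle : ∀ i, Late i → 1 / 2 - (g + d) ≤ J.proc i := fun i hi => by
    rcases hi.2.2 with h1 | h1
    · linarith
    · exact h1.2
  rcases le_or_gt (J.proc n) (1 / 2 + (g + d)) with hmed | hlong
  · refine volume_contradiction_of_medium hM hg0 hg hd0 ?_ hn.le hra0 hab (hle a hLa) (hle b hLb)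
      hmed hx (by linarith)
    -- Here jobs of `F` have length about `1/2` but start near time `1`, so their locks are damped.
    have h1 : d ≤ α / 256 * m := by
      calc d ≤ ∑ i ∈ F, σ.lock J lam α i := by linarith
        _ ≤ ∑ i ∈ F, α / 256 * J.proc i := Finset.sum_le_sum fun i hi =>
            σ.lock_le_of_proc_le_start hlam hα (by
              have := hFproc i hi
              have := (hFprop i hi).1
              linarith)
        _ = α / 256 * ∑ i ∈ F, J.proc i := (Finset.mul_sum _ _ _).symm
        _ ≤ α / 256 * m := by
            refine mul_le_mul_of_nonneg_left (le_trans ?_ hproc) (by positivity)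
            exact Finset.sum_le_univ_sum_of_nonneg fun i => (J.proc_pos i).le
    have h2 := mul_le_mul_of_nonneg_right h1 (by positivity : (0 : ℝ) ≤ 1024 * m)
    nlinarith
  · refine h.false_of_long hτ hopt (b := g + d) (g := g) (by linarith) (by linarith) hlong hzn hcinj hcz
      (fun M => hle _ (hLc M)) (fun M h1 => ?_) hFprop (by linarith) (by linarith)
      (fun i h1 h2 h3 => ?_) hg0
    · exact h.longest_first _ n ⟨h1, (hcz M).1.trans_le hzn⟩
    · have h0 : 0 ≤ σ.start i := (J.release_nonneg i).trans (h.feasible.release_le_start i)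
      constructor
      · have h4 : α / 1024 * J.proc i ≤ σ.lock J lam α i := by
          refine Schedule.le_lock_of_ratio_le (by linarith) hlam' hα ?_
          rw [div_le_iff₀ (J.proc_pos i)]
          linarith
        -- Since `p_i ≥ 2/5`, half of this inequality suffices.
        have h5 : 4 * g < α / 1024 * (4 / 5) := by
          have : (4 * g) * (m : ℝ) ^ 2 < (α / 1024 * (4 / 5)) * (m : ℝ) ^ 2 := by linarith
          exact lt_of_mul_lt_mul_right this (by positivity)
        nlinarith
      · intro k hk
        have hk1 := hτ.proc_le_one hopt k
        have hk0 := J.release_nonneg k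
        refine Schedule.lock_le_lock_of_ratio hlam hα (by linarith) ?_
        exact ratio_add_quarter_le (by linarith) (by linarith) (by linarith) (by linarith)
          (hFprop k hk).1 (J.proc_pos k) (hFproc k hk) (by linarith) h3

end Sleepy

theorem theorem1 (m : ℕ) (hm : 4 ≤ m) {ι : Type*} [Finite ι] (J : Sleepy.JobSet ι) :
    (∃ σ : Sleepy.Schedule m ι,
      Sleepy.IsSleepySchedule ((4 : ℝ) ^ (25 / 6 : ℝ)) (1 / (4 * (m : ℝ) ^ 2)) J σ) ∧
    ∀ σ : Sleepy.Schedule m ι,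
      Sleepy.IsSleepySchedule ((4 : ℝ) ^ (25 / 6 : ℝ)) (1 / (4 * (m : ℝ) ^ 2)) J σ →
        σ.makespan J ≤
          (3 / 2 - 1 / ((4 : ℝ) ^ 20 * (m : ℝ) ^ 2)) * Sleepy.optMakespan m J := by
  have hM : (4 : ℝ) ≤ m := by exact_mod_cast hm
  have hg0 : 0 ≤ 1 / ((4 : ℝ) ^ 20 * (m : ℝ) ^ 2) := by positivity
  -- The argument tolerates any `g` up to `1/(100000 m²)`; `4 ^ 20` is far larger than needed.
  have hg : 1 / ((4 : ℝ) ^ 20 * (m : ℝ) ^ 2) * (100000 * (m : ℝ) ^ 2) ≤ 1 := by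
    field_simp
    norm_num
  have hlam : (256 : ℝ) ≤ (4 : ℝ) ^ (25 / 6 : ℝ) := by
    calc (256 : ℝ) = (4 : ℝ) ^ (4 : ℝ) := by norm_num
      _ ≤ _ := Real.rpow_le_rpow_of_exponent_le (by norm_num) (by norm_num)
  have hlam' : ((4 : ℝ) ^ (25 / 6 : ℝ)) ^ (6 / 5 : ℝ) ≤ 1024 := by
    rw [← Real.rpow_mul (by norm_num)]
    norm_num
  refine ⟨Sleepy.exists_isSleepySchedule (by omega) (by positivity) (by positivity) J,
    Sleepy.makespan_le_mul_optMakespan ?_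
      (fun J σ τ hσ hτ hopt => hσ.completion_le hm hlam hlam' hg0 hg hτ hopt) J⟩
  have : 1 / ((4 : ℝ) ^ 20 * (m : ℝ) ^ 2) ≤ 1 / 1 :=
    one_div_le_one_div_of_le one_pos (by nlinarith)
  linarith
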